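/- For $n\ge 2$ let $B_n$ be the braid group on $n$ strands, i.e. the group with generators $x_1,\dots,x_{n-1}$ and relations $x_ix_jx_i=x_jx_ix_j$ if $|i-j|=1$ and $x_ix_j=x_jx_i$ if $|i-j|\ne 1$. Say that an irreducible unitary representation $\phi\colon B_n\to U(m)$ is of level $k$ (where $k\ge 0$ is an integer) if either $k=0$ and $m=1$, or $k\ge 1$ and $kn-(k^2+3k-2)\le m\le kn$. For every integer $l\ge 1$ there is an integer $N=N(l)$ such that for every integer $n\ge N$, every $m\le ln$ and every irreducible unitary representation $\phi\colon B_n\to U(m)$, there is exactly one integer $k$ with $0\le k\le l$ such that $\phi$ is of level $k$. -/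

import Mathlib

/-- The Artin relators of the braid group on `n` strands, in the free group on letters
`x_0, …, x_{n-2}`: the braid relation `x_i x_j x_i = x_j x_i x_j` when `|i - j| = 1`, and
`x_i x_j = x_j x_i` when `|i - j| ≠ 1`. -/
def braidRels (n : ℕ) : Set (FreeGroup (Fin (n - 1))) :=
  {r | ∃ i j : Fin (n - 1),
    (|(i : ℤ) - (j : ℤ)| = 1 ∧
      r = (FreeGroup.of i * FreeGroup.of j * FreeGroup.of i) *
          (FreeGroup.of j * FreeGroup.of i * FreeGroup.of j)⁻¹) ∨
    (|(i : ℤ) - (j : ℤ)| ≠ 1 ∧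
      r = (FreeGroup.of i * FreeGroup.of j) * (FreeGroup.of j * FreeGroup.of i)⁻¹)}

/-- The braid group `B_n` on `n` strands, by Artin's presentation. -/
abbrev BraidGroup (n : ℕ) : Type := PresentedGroup (braidRels n)

/-- A unitary representation of `B_n` of degree `m`: a homomorphism `B_n → U(m)`. -/
abbrev UnitaryBraidRep (n m : ℕ) : Type := BraidGroup n →* Matrix.unitaryGroup (Fin m) ℂ

namespace UnitaryBraidRep

variable {n m : ℕ}

/-- The linear representation of `B_n` on `ℂ^m` given by a homomorphism `B_n → U(m)`. -/
def toRepresentation (φ : UnitaryBraidRep n m) : Representation ℂ (BraidGroup n) (Fin m → ℂ) where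
  toFun g := Matrix.UnitaryGroup.toLin' (φ g)
  map_one' := by rw [map_one, Matrix.UnitaryGroup.toLin'_one]; rfl
  map_mul' g h := by rw [map_mul, Matrix.UnitaryGroup.toLin'_mul]; rfl

/-- `φ` is irreducible: `ℂ^m` is nonzero and has no proper nonzero invariant subspace. -/
def IsIrreducible (φ : UnitaryBraidRep n m) : Prop :=
  Representation.IsIrreducible φ.toRepresentation

/-- A (typically irreducible) unitary representation of `B_n` of degree `m` is of level `k` if
either `k = 0` and `m = 1`, or `k ≥ 1` and `kn - (k² + 3k - 2) ≤ m ≤ kn` (as integers). -/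
def IsOfLevel (_φ : UnitaryBraidRep n m) (k : ℕ) : Prop :=
  (k = 0 ∧ m = 1) ∨
    (1 ≤ k ∧ (k : ℤ) * n - ((k : ℤ) ^ 2 + 3 * k - 2) ≤ m ∧ (m : ℤ) ≤ (k : ℤ) * n)

end UnitaryBraidRep

/-! Let `t 0, …, t (M - 1)`, with `M = n - 1`, be the unitary images of the generators. The `p = n /
2` operators `t 0, t 2, t 4, …` commute, and their set of joint eigenvalue tuples is stable under
permutation of coordinates. Since `m` is linear in `n`, there are fewer than `p.choose 2` tuples,
which forces each tuple to be constant off at most one coordinate. Fixing the constant value `c` of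
one tuple, the vectors killed by all products `(t (2 a) - c) (t (2 b) - c)`, `a ≠ b`, form a nonzero
invariant subspace. By irreducibility `(t 0 - c) (t 2 - c) = 0`
(`BraidRelations.exists_mul_eq_zero`).

Let `V` be the range of `t 0 - c` and `U = t 0 ⋯ t (M - 1)`. Conjugation by `U` shifts the
generators, so `U ^ i V` is the range of `t i - c`; these ranges are orthogonal at distance at least
`2`, and if `V ≠ 0` they span the space. If `V = 0`, all generators are scalar and `m = 1`.

What remains is linear algebra of a chain in which only neighbours interact
(`FarOrthogonal.exists_finrank_bounds`). Let `D j` be the dimension of the sum of `j` consecutive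
translates, `C` the space `relationTails U V`, and `k = dim V - dim C`. Every linear relation among
translates ends in `C`, so `D` grows by at least `k` at each step; a duality argument gives `D J ≤
(J + 2) k`. As `D` is concave and superadditive across a gap, `k (n - 2) ≤ m ≤ k n`. For large `n`
this places `m` at exactly one level. -/

/-! ### Chains of subspaces in which only neighbouring translates interact -/

section Chain

variable {H : Type*} [NormedAddCommGroup H] [InnerProductSpace ℂ H]

/-- The sum `V + U V + ⋯ + U ^ (j - 1) V` of the first `j` translates of `V`. -/
def shiftSpan (U : H ≃ₗᵢ[ℂ] H) (V : Submodule ℂ H) : ℕ → Submodule ℂ H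
  | 0 => ⊥
  | j + 1 => shiftSpan U V j ⊔ V.map (U ^ j).toLinearEquiv.toLinearMap

/-- Translates of `V` by `U` at distance between `2` and `R` are orthogonal. -/
def FarOrthogonal (U : H ≃ₗᵢ[ℂ] H) (V : Submodule ℂ H) (R : ℕ) : Prop :=
  ∀ j : ℕ, 2 ≤ j → j ≤ R → ∀ x ∈ V, ∀ y ∈ V, inner ℂ x ((U ^ j) y) = 0

/-- A family `f` of vectors of `V` such that `U ^ q V` is orthogonal to
`U ^ (q - 1) f (q - 1) + U ^ q f q + U ^ (q + 1) f (q + 1)` for all `q`. -/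
def LocalRelation (U : H ≃ₗᵢ[ℂ] H) (V : Submodule ℂ H) (f : ℤ → H) : Prop :=
  (∀ i, f i ∈ V) ∧
    ∀ q, ∀ y ∈ V, inner ℂ y (U⁻¹ (f (q - 1)) + f q + U (f (q + 1))) = 0

/-- The last terms of the local relations that vanish at positive indices. -/
def relationTails (U : H ≃ₗᵢ[ℂ] H) (V : Submodule ℂ H) : Submodule ℂ H where
  carrier := {x | ∃ f : ℤ → H, LocalRelation U V f ∧ f 0 = x ∧ ∀ i, 0 < i → f i = 0}
  zero_mem' := ⟨0, ⟨by simp, by simp⟩, rfl, by simp⟩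
  add_mem' := by
    rintro x y ⟨f, hf, rfl, hf0⟩ ⟨g, hg, rfl, hg0⟩
    refine ⟨f + g, ⟨fun i => V.add_mem (hf.1 i) (hg.1 i), fun q y hy => ?_⟩, rfl, fun i hi => ?_⟩
    · have h1 := hf.2 q y hy
      have h2 := hg.2 q y hy
      simp only [inner_add_right, Pi.add_apply, map_add] at h1 h2 ⊢
      linear_combination h1 + h2
    · simp [hf0 i hi, hg0 i hi]
  smul_mem' := by
    rintro c x ⟨f, hf, rfl, hf0⟩
    refine ⟨c • f, ⟨fun i => V.smul_mem c (hf.1 i), fun q y hy => ?_⟩, rfl, fun i hi => ?_⟩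
    · have h1 := hf.2 q y hy
      simp only [inner_add_right, Pi.smul_apply, map_smul, inner_smul_right] at h1 ⊢
      linear_combination c * h1
    · simp [hf0 i hi]

variable {U : H ≃ₗᵢ[ℂ] H} {V : Submodule ℂ H} {R : ℕ}

lemma relationTails_le : relationTails U V ≤ V := by
  rintro x ⟨f, hf, rfl, -⟩
  exact hf.1 0

lemma LinearIsometryEquiv.inner_zpow_zpow (U : H ≃ₗᵢ[ℂ] H) (a b : ℤ) (x y : H) :
    inner ℂ ((U ^ a) x) ((U ^ b) y) = inner ℂ x ((U ^ (b - a)) y) := by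
  have h : (U ^ b) y = (U ^ a) ((U ^ (b - a)) y) := by
    rw [← Function.comp_apply (f := U ^ a), ← LinearIsometryEquiv.coe_mul, ← zpow_add,
      add_sub_cancel]
  rw [h, LinearIsometryEquiv.inner_map_map]

lemma FarOrthogonal.inner_eq_zero (hV : FarOrthogonal U V R) {a b : ℤ} (h2 : 2 ≤ |a - b|)
    (hR : |a - b| ≤ R) {x y : H} (hx : x ∈ V) (hy : y ∈ V) :
    inner ℂ ((U ^ a) x) ((U ^ b) y) = 0 := by
  rcases le_total a b with hab | hab
  · obtain ⟨c, hc⟩ := Int.le.dest hab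
    rw [LinearIsometryEquiv.inner_zpow_zpow, show b - a = (c : ℤ) by lia, zpow_natCast]
    exact hV c (by grind) (by grind) x hx y hy
  · obtain ⟨c, hc⟩ := Int.le.dest hab
    rw [← inner_conj_symm, LinearIsometryEquiv.inner_zpow_zpow,
      show a - b = (c : ℤ) by lia, zpow_natCast,
      hV c (by grind) (by grind) y hy x hx, map_zero]

/-- Only the neighbours `q - 1, q, q + 1` can contribute. This turns orthogonality to a finite sum
of translates into the condition in `LocalRelation`, which no longer mentions `R`. -/
lemma FarOrthogonal.inner_sum (hV : FarOrthogonal U V R) {F : ℤ → H} (hF : ∀ i, F i ∈ V)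
    (s : Finset ℤ) (q : ℤ) (hs : ∀ i ∈ s, |q - i| ≤ R)
    (hs' : ∀ i, |q - i| ≤ 1 → i ∉ s → F i = 0) {y : H} (hy : y ∈ V) :
    inner ℂ ((U ^ q) y) (∑ i ∈ s, (U ^ i) (F i)) =
      inner ℂ y (U⁻¹ (F (q - 1)) + F q + U (F (q + 1))) := by
  have h1 : ∑ i ∈ s, inner ℂ ((U ^ q) y) ((U ^ i) (F i)) =
      ∑ i ∈ ({q - 1, q, q + 1} : Finset ℤ), inner ℂ ((U ^ q) y) ((U ^ i) (F i)) := by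
    rw [Finset.sum_subset (Finset.subset_union_left (s₁ := s) (s₂ := {q - 1, q, q + 1})),
      Finset.sum_subset (Finset.subset_union_right (s₁ := s) (s₂ := {q - 1, q, q + 1}))]
    · intro i hi hi'
      simp only [Finset.mem_insert, Finset.mem_singleton] at hi'
      have his : i ∈ s := (Finset.mem_union.mp hi).resolve_right (by simpa using hi')
      exact hV.inner_eq_zero (by rw [le_abs]; lia) (hs i his) hy (hF i)
    · intro i hi hi'
      have hiq := (Finset.mem_union.mp hi).resolve_left hi'
      simp only [Finset.mem_insert, Finset.mem_singleton] at hiq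
      rw [hs' i (by rw [abs_le]; lia) hi', map_zero, inner_zero_right]
  rw [_root_.inner_sum, h1, Finset.sum_insert (by simp; lia), Finset.sum_insert (by simp),
    Finset.sum_singleton, LinearIsometryEquiv.inner_zpow_zpow,
    LinearIsometryEquiv.inner_zpow_zpow, LinearIsometryEquiv.inner_zpow_zpow, inner_add_right,
    inner_add_right, show q - 1 - q = -1 by ring, sub_self, show q + 1 - q = 1 by ring,
    zpow_neg_one, zpow_zero, zpow_one, LinearIsometryEquiv.coe_one, id_eq, add_assoc]

lemma mem_shiftSpan {j : ℕ} {x : H} (hx : x ∈ shiftSpan U V j) :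
    ∃ w : ℤ → H, (∀ i, w i ∈ V) ∧ (∀ i, i ∉ Finset.Ico (0 : ℤ) j → w i = 0) ∧
      x = ∑ i ∈ Finset.Ico (0 : ℤ) j, (U ^ i) (w i) := by
  induction j generalizing x with
  | zero =>
    refine ⟨0, by simp, by simp, ?_⟩
    simpa [shiftSpan] using hx
  | succ j ih =>
    obtain ⟨y, hy, _, ⟨z, hz, rfl⟩, rfl⟩ := Submodule.mem_sup.mp hx
    obtain ⟨w, hw, hw0, rfl⟩ := ih hy
    refine ⟨Function.update w j z, fun i => ?_, fun i hi => ?_, ?_⟩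
    · by_cases h : i = j
      · subst h; simpa using hz
      · simpa [h] using hw i
    · have h : i ≠ j := by rintro rfl; simp at hi
      rw [Function.update_of_ne h]
      exact hw0 i (by simp only [Finset.mem_Ico] at hi ⊢; lia)
    · have h : Finset.Ico (0 : ℤ) (j + 1 : ℕ) = insert (j : ℤ) (Finset.Ico (0 : ℤ) j) := by
        ext i; simp only [Finset.mem_insert, Finset.mem_Ico]; lia
      rw [h, Finset.sum_insert (by simp), add_comm]
      congr 1
      · simp
      · refine Finset.sum_congr rfl fun i hi => ?_
        rw [Function.update_of_ne]
        rintro rfl; simp at hi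

lemma pow_apply_mem_shiftSpan {j i : ℕ} (h : i < j) {x : H} (hx : x ∈ V) :
    (U ^ i) x ∈ shiftSpan U V j := by
  induction j with
  | zero => lia
  | succ j ih =>
    rcases Nat.lt_succ_iff_lt_or_eq.mp h with h | rfl
    · exact Submodule.mem_sup_left (ih h)
    · exact Submodule.mem_sup_right ⟨x, hx, rfl⟩

/-- Relations of length at most `R` between translates of `V` are local relations. -/
lemma FarOrthogonal.mem_relationTails (hV : FarOrthogonal U V R) {j : ℕ} (hj : j + 1 ≤ R) {x : H}
    (hx : x ∈ V) (hUx : (U ^ j) x ∈ shiftSpan U V j) : x ∈ relationTails U V := by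
  obtain ⟨w, hw, hw0, hsum⟩ := mem_shiftSpan hUx
  let g : ℤ → H := fun i => if i = j then x else - w i
  have hg : ∀ i, g i ∈ V := fun i => by
    by_cases h : i = j
    · simpa [g, h] using hx
    · simpa [g, h] using hw i
  have hg0 : ∀ i, i ∉ Finset.Icc (0 : ℤ) j → g i = 0 := fun i hi => by
    have h : i ≠ j := by rintro rfl; simp at hi
    simp only [g, h, if_false, neg_eq_zero]
    exact hw0 i (by simp only [Finset.mem_Icc, Finset.mem_Ico] at hi ⊢; lia)
  have hgs : ∑ i ∈ Finset.Icc (0 : ℤ) j, (U ^ i) (g i) = 0 := by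
    have h : Finset.Icc (0 : ℤ) j = insert (j : ℤ) (Finset.Ico (0 : ℤ) j) := by
      ext i; simp only [Finset.mem_insert, Finset.mem_Icc, Finset.mem_Ico]; lia
    rw [h, Finset.sum_insert (by simp)]
    have h' : ∑ i ∈ Finset.Ico (0 : ℤ) j, (U ^ i) (g i) =
        - ∑ i ∈ Finset.Ico (0 : ℤ) j, (U ^ i) (w i) := by
      rw [← Finset.sum_neg_distrib]
      refine Finset.sum_congr rfl fun i hi => ?_
      have : i ≠ j := by rintro rfl; simp at hi
      simp [g, this]
    rw [h', ← hsum]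
    simp [g]
  have hloc : ∀ q, ∀ y ∈ V, inner ℂ y (U⁻¹ (g (q - 1)) + g q + U (g (q + 1))) = 0 := by
    intro q y hy
    -- For these `q` every index of the relation is within `j + 1 ≤ R`, so the vanishing sum can be
    -- tested against `U ^ q V`. For other `q` all three neighbouring terms are zero.
    by_cases hq : -1 ≤ q ∧ q ≤ j + 1
    · rw [← hV.inner_sum hg (Finset.Icc (0 : ℤ) j) q ?_ (fun i _ hi => hg0 i hi) hy, hgs,
        inner_zero_right]
      intro i hi
      simp only [Finset.mem_Icc] at hi
      rw [abs_le]; lia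
    · rw [hg0 _ (by simp only [Finset.mem_Icc]; lia), hg0 _ (by simp only [Finset.mem_Icc]; lia),
        hg0 _ (by simp only [Finset.mem_Icc]; lia)]
      simp
  refine ⟨fun i => g (i + j), ⟨fun i => hg _, fun q y hy => ?_⟩, by simp [g], fun i hi =>
    hg0 _ (by simp only [Finset.mem_Icc]; lia)⟩
  have := hloc (q + j) y hy
  rwa [show q + j - 1 = q - 1 + (j : ℤ) by ring, show q + j + 1 = q + 1 + (j : ℤ) by ring] at this

/-- A vector of the span of `J` consecutive translates is determined by its projections to
translates of the orthogonal complement of `relationTails U V` in `V`. -/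
lemma FarOrthogonal.eq_zero_of_forall_inner [FiniteDimensional ℂ H] (hV : FarOrthogonal U V R)
    {J : ℕ} (hJ : J ≤ R) {v : H} (hv : v ∈ shiftSpan U V J)
    (h : ∀ p ∈ Finset.Icc (-1 : ℤ) J, ∀ y ∈ (relationTails U V)ᗮ ⊓ V,
      inner ℂ ((U ^ p) y) v = 0) : v = 0 := by
  obtain ⟨w, hw, hw0, hsum⟩ := mem_shiftSpan hv
  let u : ℤ → H := fun p => V.starProjection ((U ^ (-p)) v)
  have huV : ∀ p, u p ∈ V := fun p => Submodule.starProjection_apply_mem _ _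
  have hu : ∀ p, ∀ y ∈ V, inner ℂ y (u p) = inner ℂ ((U ^ p) y) v := by
    intro p y hy
    have h1 : inner ℂ y ((U ^ (-p)) v) = inner ℂ ((U ^ p) y) v := by
      have := LinearIsometryEquiv.inner_zpow_zpow U p 0 y v
      simpa using this.symm
    rw [← h1, ← Submodule.inner_starProjection_left_eq_right, Submodule.starProjection_eq_self_iff.mpr hy]
  have huC : ∀ p ∈ Finset.Icc (-1 : ℤ) J, u p ∈ relationTails U V := by
    intro p hp
    set C := relationTails U V
    have h1 : u p - C.starProjection (u p) ∈ Cᗮ ⊓ V :=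
      ⟨Submodule.sub_starProjection_mem_orthogonal _, V.sub_mem (huV p)
        (relationTails_le (Submodule.starProjection_apply_mem _ _))⟩
    have h2 := h p hp _ h1
    rw [← hu p _ h1.2] at h2
    have h3 : inner ℂ (u p - C.starProjection (u p)) (C.starProjection (u p)) = 0 :=
      Submodule.inner_left_of_mem_orthogonal (Submodule.starProjection_apply_mem _ _) h1.1
    have h4 : u p - C.starProjection (u p) = 0 := by
      rw [← inner_self_eq_zero (𝕜 := ℂ), inner_sub_right, h2, h3, sub_zero]
    rw [sub_eq_zero.mp h4]
    exact Submodule.starProjection_apply_mem _ _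
  -- Induction from left to right. Since `u p` is the tail of a local relation `f`, shift `f` to end
  -- at `p`: its sum over the window is orthogonal to `v`, because the window contains both
  -- neighbours of each index in `[0, J)`. Pairing with `v`, the terms left of `p` vanish by
  -- induction and those right of `p` since `f` does, leaving `‖u p‖² = 0`.
  have hu0 : ∀ n : ℕ, ∀ p : ℤ, p + 1 < n → p ∈ Finset.Icc (-1 : ℤ) J → u p = 0 := by
    intro n
    induction n with
    | zero => intro p hp hp'; simp only [Finset.mem_Icc] at hp'; lia
    | succ n ih =>
      intro p hp hpJ
      obtain ⟨f, hf, hfp, hf0⟩ := huC p hpJ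
      have hsum0 : inner ℂ v (∑ i ∈ Finset.Icc (-1 : ℤ) J, (U ^ i) (f (i - p))) = 0 := by
        rw [hsum, sum_inner]
        refine Finset.sum_eq_zero fun q hq => ?_
        simp only [Finset.mem_Ico] at hq
        rw [hV.inner_sum (F := fun i => f (i - p)) (fun i => hf.1 _) _ q ?_ ?_ (hw q)]
        · have := hf.2 (q - p) (w q) (hw q)
          rwa [show q - p - 1 = q - 1 - p by ring, show q - p + 1 = q + 1 - p by ring] at this
        · intro i hi
          simp only [Finset.mem_Icc] at hi
          rw [abs_le]; lia
        · intro i hi hi'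
          simp only [Finset.mem_Icc] at hi'
          rw [abs_le] at hi; lia
      rw [← inner_conj_symm, map_eq_zero, sum_inner, Finset.sum_eq_single_of_mem p hpJ] at hsum0
      · rw [← hu p _ (hf.1 _), sub_self, hfp, inner_self_eq_zero] at hsum0
        exact hsum0
      · intro i hi hip
        rw [← hu i _ (hf.1 _)]
        rcases lt_or_gt_of_ne hip with h1 | h1
        · rw [ih i (by lia) hi, inner_zero_right]
        · rw [hf0 _ (by lia), inner_zero_left]
  rw [← inner_self_eq_zero (𝕜 := ℂ)]
  nth_rewrite 1 [hsum]
  rw [sum_inner]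
  refine Finset.sum_eq_zero fun q hq => ?_
  simp only [Finset.mem_Ico] at hq
  rw [← hu q _ (hw q), hu0 (J + 2) q (by push_cast; lia) (by simp only [Finset.mem_Icc]; lia),
    inner_zero_right]

lemma shiftSpan_succ' (j : ℕ) :
    shiftSpan U V (j + 1) = V ⊔ (shiftSpan U V j).map U.toLinearEquiv.toLinearMap := by
  induction j with
  | zero =>
    simp only [shiftSpan, Submodule.map_bot, bot_sup_eq, sup_bot_eq]
    exact Submodule.map_id V
  | succ j ih =>
    have h (i : ℕ) : shiftSpan U V (i + 1) =
        shiftSpan U V i ⊔ V.map (U ^ i).toLinearEquiv.toLinearMap := rfl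
    rw [h (j + 1)]
    nth_rewrite 1 [ih]
    rw [sup_assoc, h j, Submodule.map_sup, ← Submodule.map_comp]
    congr 3
    ext x
    simp [pow_succ']

lemma shiftSpan_mono : Monotone (shiftSpan U V) :=
  monotone_nat_of_le_succ fun _ => le_sup_left

lemma map_pow_shiftSpan_le (i j : ℕ) :
    (shiftSpan U V j).map (U ^ i).toLinearEquiv.toLinearMap ≤ shiftSpan U V (i + j) := by
  induction j with
  | zero => simp [shiftSpan]
  | succ j ih =>
    rw [shiftSpan, Submodule.map_sup, ← add_assoc]
    refine sup_le (ih.trans (shiftSpan_mono (Nat.le_succ _))) ?_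
    rintro _ ⟨_, ⟨x, hx, rfl⟩, rfl⟩
    have : (U ^ (i + j)) x ∈ shiftSpan U V (i + j + 1) := pow_apply_mem_shiftSpan (by lia) hx
    rwa [pow_add] at this

/-! ### Dimensions of the sums of consecutive translates -/

section Dimensions

open Module

lemma finrank_map_linearIsometryEquiv (g : H ≃ₗᵢ[ℂ] H) (K : Submodule ℂ H) :
    finrank ℂ (K.map g.toLinearEquiv.toLinearMap) = finrank ℂ K :=
  LinearEquiv.finrank_map_eq g.toLinearEquiv K

variable [FiniteDimensional ℂ H]

/-- The sum of `j + 2` translates is `S + U S`, where `S` is the sum of the first `j + 1`, and `S ∩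
U S` contains the shifted sum of `j` translates. -/
lemma finrank_shiftSpan_concave (j : ℕ) :
    finrank ℂ (shiftSpan U V (j + 2)) + finrank ℂ (shiftSpan U V j) ≤
      2 * finrank ℂ (shiftSpan U V (j + 1)) := by
  have h := Submodule.finrank_sup_add_finrank_inf_eq (shiftSpan U V (j + 1))
    ((shiftSpan U V (j + 1)).map U.toLinearEquiv.toLinearMap)
  rw [finrank_map_linearIsometryEquiv] at h
  have h1 : shiftSpan U V (j + 2) ≤ shiftSpan U V (j + 1) ⊔
      (shiftSpan U V (j + 1)).map U.toLinearEquiv.toLinearMap := by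
    rw [shiftSpan_succ' (j + 1)]
    refine sup_le_sup_right ?_ _
    rw [shiftSpan_succ']
    exact le_sup_left
  have h2 : (shiftSpan U V j).map U.toLinearEquiv.toLinearMap ≤ shiftSpan U V (j + 1) ⊓
      (shiftSpan U V (j + 1)).map U.toLinearEquiv.toLinearMap := by
    refine le_inf ?_ (Submodule.map_mono (shiftSpan_mono (Nat.le_succ _)))
    rw [shiftSpan_succ']
    exact le_sup_right
  have h3 := Submodule.finrank_mono h1
  have h4 := Submodule.finrank_mono h2
  rw [finrank_map_linearIsometryEquiv] at h4
  lia

lemma finrank_relationTails_add :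
    finrank ℂ (relationTails U V) + finrank ℂ ((relationTails U V)ᗮ ⊓ V : Submodule ℂ H) =
      finrank ℂ V :=
  Submodule.finrank_add_inf_finrank_orthogonal relationTails_le

/-- The new translate meets the previous sum only inside the translate of `relationTails U V`. -/
lemma FarOrthogonal.finrank_shiftSpan_succ_ge (hV : FarOrthogonal U V R) {j : ℕ}
    (hj : j + 1 ≤ R) :
    finrank ℂ (shiftSpan U V j) + finrank ℂ ((relationTails U V)ᗮ ⊓ V : Submodule ℂ H) ≤
      finrank ℂ (shiftSpan U V (j + 1)) := by
  have h := Submodule.finrank_sup_add_finrank_inf_eq (shiftSpan U V j)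
    (V.map (U ^ j).toLinearEquiv.toLinearMap)
  rw [finrank_map_linearIsometryEquiv] at h
  have h0 := finrank_relationTails_add (U := U) (V := V)
  have h1 : shiftSpan U V j ⊓ V.map (U ^ j).toLinearEquiv.toLinearMap ≤
      (relationTails U V).map (U ^ j).toLinearEquiv.toLinearMap := by
    rintro _ ⟨h1, ⟨x, hx, rfl⟩⟩
    exact ⟨x, hV.mem_relationTails hj hx h1, rfl⟩
  have h2 := Submodule.finrank_mono h1
  rw [finrank_map_linearIsometryEquiv] at h2
  rw [shiftSpan]
  lia

/-- The projections in `FarOrthogonal.eq_zero_of_forall_inner` give an injection into `J + 2` copies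
of the complement, one for each `p` from `-1` to `J`. -/
lemma FarOrthogonal.finrank_shiftSpan_le (hV : FarOrthogonal U V R) {J : ℕ} (hJ : J ≤ R) :
    finrank ℂ (shiftSpan U V J) ≤
      (J + 2) * finrank ℂ ((relationTails U V)ᗮ ⊓ V : Submodule ℂ H) := by
  set D := (relationTails U V)ᗮ ⊓ V with hD
  let Φ : shiftSpan U V J →ₗ[ℂ] (Finset.Icc (-1 : ℤ) J → D) :=
    LinearMap.pi fun p => D.orthogonalProjectionOnto.toLinearMap ∘ₗ
      (U ^ (-p.1)).toLinearEquiv.toLinearMap ∘ₗ (shiftSpan U V J).subtype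
  have hΦ : Function.Injective Φ := by
    rw [← LinearMap.ker_eq_bot, LinearMap.ker_eq_bot']
    rintro ⟨v, hv⟩ h0
    refine Subtype.ext (hV.eq_zero_of_forall_inner hJ hv fun p hp y hy => ?_)
    have h1 : D.orthogonalProjectionOnto ((U ^ (-p)) v) = 0 := congrFun h0 ⟨p, hp⟩
    rw [Submodule.orthogonalProjectionOnto_eq_zero_iff] at h1
    have h2 := LinearIsometryEquiv.inner_zpow_zpow U p 0 y v
    rw [zpow_zero, LinearIsometryEquiv.coe_one, id_eq, zero_sub] at h2
    rw [h2]
    exact Submodule.inner_right_of_mem_orthogonal hy h1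
  have h := LinearMap.finrank_le_finrank_of_injective hΦ
  rw [Module.finrank_pi_fintype, Finset.sum_const, Finset.card_univ, Fintype.card_coe,
    Int.card_Icc, smul_eq_mul] at h
  convert h using 2
  lia

/-- Skipping the translate with index `a` leaves two mutually orthogonal blocks. -/
lemma FarOrthogonal.finrank_shiftSpan_add_le (hV : FarOrthogonal U V R) {a j : ℕ}
    (h : a + 1 + j ≤ R + 1) :
    finrank ℂ (shiftSpan U V a) + finrank ℂ (shiftSpan U V j) ≤
      finrank ℂ (shiftSpan U V (a + 1 + j)) := by
  have h1 := Submodule.finrank_sup_add_finrank_inf_eq (shiftSpan U V a)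
    ((shiftSpan U V j).map (U ^ (a + 1)).toLinearEquiv.toLinearMap)
  rw [finrank_map_linearIsometryEquiv] at h1
  have h2 : shiftSpan U V a ⊔ (shiftSpan U V j).map (U ^ (a + 1)).toLinearEquiv.toLinearMap ≤
      shiftSpan U V (a + 1 + j) :=
    sup_le (shiftSpan_mono (by lia)) (map_pow_shiftSpan_le _ _)
  have h3 : shiftSpan U V a ⊓ (shiftSpan U V j).map (U ^ (a + 1)).toLinearEquiv.toLinearMap =
      ⊥ := by
    rw [Submodule.eq_bot_iff]
    rintro _ ⟨hx, ⟨y, hy, rfl⟩⟩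
    obtain ⟨w, hw, -, hws⟩ := mem_shiftSpan hx
    obtain ⟨z, hz, -, rfl⟩ := mem_shiftSpan hy
    rw [← inner_self_eq_zero (𝕜 := ℂ)]
    nth_rewrite 1 [hws]
    rw [sum_inner]
    refine Finset.sum_eq_zero fun p hp => ?_
    rw [map_sum, _root_.inner_sum]
    refine Finset.sum_eq_zero fun q hq => ?_
    simp only [Finset.mem_Ico] at hp hq
    have := hV.inner_eq_zero (a := p) (b := (a + 1 : ℕ) + q) (by rw [le_abs]; push_cast; lia)
      (by rw [abs_le]; push_cast; lia) (hw p) (hz q)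
    rwa [zpow_add, zpow_natCast] at this
  rw [h3, finrank_bot, add_zero] at h1
  rw [← h1]
  exact Submodule.finrank_mono h2

end Dimensions

/-- A concave sequence with slope at least `k` that lies below `k (J + 2)` and satisfies a weak
superadditivity is within a bounded distance of `k J`. -/
lemma le_mul_of_concave {D : ℕ → ℕ} {k R : ℕ} (hR : 4 * k + 3 ≤ R)
    (hconc : ∀ j, D (j + 2) + D j ≤ 2 * D (j + 1))
    (hlow : ∀ j, j + 1 ≤ R → D j + k ≤ D (j + 1)) (hup : ∀ J, J ≤ R → D J ≤ (J + 2) * k)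
    (hadd : ∀ a j, a + 1 + j ≤ R + 1 → D a + D j ≤ D (a + 1 + j)) :
    k * R ≤ D (R + 1) ∧ D (R + 1) ≤ k * (R + 2) := by
  have hanti : ∀ i j, i ≤ j → D (j + 1) + D i ≤ D (i + 1) + D j := by
    intro i j hij
    induction j, hij using Nat.le_induction with
    | base => lia
    | succ j hij ih => have := hconc j; lia
  -- Otherwise concavity makes all earlier slopes at least `k + 1`, and `(k + 1) (2 k + 2)` exceeds
  -- the upper bound `(2 k + 4) k`.
  have hstep : D (2 * k + 2) ≤ D (2 * k + 1) + k := by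
    by_contra! hc
    have : ∀ j, j ≤ 2 * k + 2 → (k + 1) * j ≤ D j := by
      intro j
      induction j with
      | zero => simp
      | succ j ih =>
        intro hj
        have h1 := ih (by lia)
        have h2 := hanti j (2 * k + 1) (by lia)
        have h3 : D (2 * k + 1 + 1) = D (2 * k + 2) := rfl
        rw [mul_add, mul_one]
        lia
    have h1 := this (2 * k + 2) le_rfl
    have h2 := hup (2 * k + 2) (by lia)
    nlinarith
  have hstep' : ∀ j, 2 * k + 1 ≤ j → D (j + 1) ≤ D j + k := by
    intro j hj
    have h2 := hanti (2 * k + 1) j hj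
    have h3 : D (2 * k + 1 + 1) = D (2 * k + 2) := rfl
    lia
  have hlin : ∀ i, D (2 * k + 1 + i) ≤ D (2 * k + 1) + k * i := by
    intro i
    induction i with
    | zero => simp
    | succ i ih =>
      have := hstep' (2 * k + 1 + i) (by lia)
      rw [mul_add, mul_one, ← add_assoc]
      lia
  have hlin' : ∀ j, j ≤ R → k * j ≤ D j := by
    intro j
    induction j with
    | zero => simp
    | succ j ih =>
      intro hj
      have h1 := ih (by lia)
      have h2 := hlow j hj
      rw [mul_add, mul_one]
      lia
  constructor
  · have h1 := hlin' R le_rfl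
    obtain ⟨R', rfl⟩ : ∃ R', R = R' + 1 := ⟨R - 1, by lia⟩
    have h2 := hadd (R' + 1) 0 (by lia)
    have h3 : D (R' + 1 + 1 + 0) = D (R' + 1 + 1) := rfl
    lia
  · obtain ⟨i, hi⟩ : ∃ i, R + 1 = 2 * k + 1 + i := ⟨R - 2 * k, by lia⟩
    have h1 := hlin i
    have h2 := hlin (2 * k + 2)
    -- With the slope bound this gives `2 D (2 k + 1) ≤ D (4 k + 3) ≤ D (2 k + 1) + k (2 k + 2)`,
    -- hence `D (2 k + 1) ≤ k (2 k + 2)`: the constant term in the linear bound becomes exactly `k`.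
    have h3 := hadd (2 * k + 1) (2 * k + 1) (by lia)
    have h4 : D (2 * k + 1 + 1 + (2 * k + 1)) = D (2 * k + 1 + (2 * k + 2)) := by
      congr 1; lia
    rw [hi]
    have h5 : k * (R + 2) = k * (2 * k + 2) + k * i := by
      rw [← mul_add]; congr 1; lia
    lia

open Module in
/-- If the `R + 1` translates `V, U V, …, U ^ R V` span the space and those at distance at least `2`
are orthogonal, then the dimension is between `k R` and `k (R + 2)` for some `k`. -/
theorem FarOrthogonal.exists_finrank_bounds [FiniteDimensional ℂ H] (hV : FarOrthogonal U V R)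
    (hne : V ≠ ⊥) (hspan : shiftSpan U V (R + 1) = ⊤) (hR : 4 * finrank ℂ V + 3 ≤ R) :
    ∃ k, 1 ≤ k ∧ k * R ≤ finrank ℂ H ∧ finrank ℂ H ≤ k * (R + 2) := by
  set k := finrank ℂ ((relationTails U V)ᗮ ⊓ V : Submodule ℂ H) with hk
  have hkV : k ≤ finrank ℂ V := Submodule.finrank_mono inf_le_right
  have h := le_mul_of_concave (D := fun j => finrank ℂ (shiftSpan U V j)) (k := k) (R := R)
    (by lia) (fun j => finrank_shiftSpan_concave j)
    (fun j hj => hV.finrank_shiftSpan_succ_ge hj) (fun J hJ => hV.finrank_shiftSpan_le hJ)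
    (fun a j haj => hV.finrank_shiftSpan_add_le haj)
  rw [hspan, finrank_top] at h
  refine ⟨k, ?_, h⟩
  by_contra! hk0
  have h1 := h.2
  rw [show k = 0 by lia, zero_mul] at h1
  have h2 : finrank ℂ V ≤ finrank ℂ H := Submodule.finrank_le V
  exact hne (Submodule.finrank_eq_zero.mp (by lia))

end Chain

/-! ### Small sets of tuples stable under permutations -/

section Combinatorics

lemma Nat.choose_two_le_choose {p s : ℕ} (h2 : 2 ≤ s) (hs : s + 2 ≤ p) :
    p.choose 2 ≤ p.choose s := by
  induction p generalizing s with
  | zero => lia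
  | succ p ih =>
    rcases Nat.lt_or_ge p (s + 2) with h | h
    · have : p + 1 = s + 2 := by lia
      rw [this, ← Nat.choose_symm_add]
    · obtain ⟨s, rfl⟩ : ∃ s', s = s' + 1 := ⟨s - 1, by lia⟩
      have h1 := ih h2 h
      rw [Nat.choose_succ_succ', Nat.choose_succ_succ', Nat.choose_one_right]
      rcases Nat.lt_or_ge s 2 with h3 | h3
      · obtain rfl : s = 1 := by lia
        simp
      · have h4 := ih h3 (by lia)
        have h5 : p ≤ p.choose 2 := by
          rw [Nat.choose_two_right, Nat.le_div_iff_mul_le two_pos]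
          exact Nat.mul_le_mul le_rfl (by lia)
        lia

variable {α : Type*} {p : ℕ} {O : Set (Fin p → α)}

lemma comp_perm_mem_of_comp_swap_mem
    (hO : ∀ f ∈ O, ∀ (i : ℕ) (hi : i + 1 < p),
      f ∘ Equiv.swap (⟨i, by lia⟩ : Fin p) ⟨i + 1, hi⟩ ∈ O) :
    ∀ σ : Equiv.Perm (Fin p), ∀ f ∈ O, f ∘ σ ∈ O := by
  cases p with
  | zero => exact fun σ f hf => by rwa [Subsingleton.elim (f ∘ σ) f]
  | succ q =>
    intro σ
    have hσ : σ ∈ Submonoid.closure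
        (Set.range fun i : Fin q => Equiv.swap i.castSucc i.succ) := by
      rw [Equiv.Perm.mclosure_swap_castSucc_succ]; trivial
    induction hσ using Submonoid.closure_induction with
    | mem x hx =>
      obtain ⟨i, rfl⟩ := hx
      exact fun f hf => hO f hf i (by simp)
    | one => exact fun f hf => hf
    | mul x y _ _ hx hy => exact fun f hf => hy _ (hx f hf)

/-- If a function in a set stable under permutations of the arguments is not constant off one
argument, then the set has at least `p.choose 2` elements. -/
lemma exists_eq_or_eq_of_ncard_lt (hp : 4 ≤ p) (hfin : O.Finite)
    (hO : ∀ σ : Equiv.Perm (Fin p), ∀ f ∈ O, f ∘ σ ∈ O) (hcard : O.ncard < p.choose 2)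
    {f : Fin p → α} (hf : f ∈ O) : ∃ c, ∀ i j, i ≠ j → f i = c ∨ f j = c := by
  classical
  by_contra! hne
  -- A preimage `S` of `f` with `2 ≤ |S| ≤ p - 2`: the preimage of two values if `f` is injective,
  -- and otherwise that of a repeated value, which two arguments avoid by assumption.
  obtain ⟨S, A, hSA, h2, hS⟩ : ∃ (S : Finset (Fin p)) (A : Set α), (∀ i, i ∈ S ↔ f i ∈ A) ∧
      2 ≤ S.card ∧ S.card + 2 ≤ p := by
    by_cases hinj : Function.Injective f
    · refine ⟨{⟨0, by lia⟩, ⟨1, by lia⟩}, {f ⟨0, by lia⟩, f ⟨1, by lia⟩}, fun i => ?_, ?_⟩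
      · simp [hinj.eq_iff]
      · rw [Finset.card_pair (by simp)]
        lia
    · obtain ⟨i, j, hij, hne'⟩ : ∃ i j, f i = f j ∧ i ≠ j := by
        simpa [Function.Injective] using hinj
      refine ⟨Finset.univ.filter fun x => f x = f i, {f i}, fun x => by simp, ?_, ?_⟩
      · rw [← Finset.card_pair hne']
        refine Finset.card_le_card fun x hx => ?_
        rcases Finset.mem_insert.mp hx with rfl | hx
        · simp
        · rw [Finset.mem_singleton] at hx; subst hx; simp [hij]
      · obtain ⟨a, b, hab, ha, hb⟩ := hne (f i)
        have h1 := Finset.card_filter_add_card_filter_not (s := Finset.univ (α := Fin p))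
          (fun x => f x = f i)
        rw [Finset.card_univ, Fintype.card_fin] at h1
        have h3 : 2 ≤ (Finset.univ.filter fun x => ¬ f x = f i).card := by
          rw [← Finset.card_pair hab]
          refine Finset.card_le_card fun x hx => ?_
          rcases Finset.mem_insert.mp hx with rfl | hx
          · simpa using ha
          · rw [Finset.mem_singleton] at hx; subst hx; simpa using hb
        lia
  -- Permuting `f` realises every set of size `|S|` as a preimage of `A`, so there are at least
  -- `p.choose |S|` functions.
  have hsub : Finset.powersetCard S.card Finset.univ ⊆
      hfin.toFinset.image fun g => Finset.univ.filter fun i => g i ∈ A := by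
    intro T hT
    obtain ⟨σ, hσ⟩ := Equiv.Perm.exists_map_finset_eq T S (Finset.mem_powersetCard.mp hT).2
    refine Finset.mem_image.mpr ⟨f ∘ σ, hfin.mem_toFinset.mpr (hO σ f hf), ?_⟩
    ext i
    have : σ i ∈ S ↔ i ∈ T := by
      rw [← hσ]
      simp
    simpa [hSA] using this
  have h3 := (Finset.card_le_card hsub).trans Finset.card_image_le
  rw [Finset.card_powersetCard, Finset.card_univ, Fintype.card_fin,
    ← Set.ncard_eq_toFinset_card O hfin] at h3
  exact absurd ((Nat.choose_two_le_choose h2 hS).trans h3) (by lia)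

end Combinatorics

/-! ### Conjugations in a group satisfying the braid relations -/

section BraidRelations

/-- The braid relations for the first `M` elements of a sequence. -/
structure BraidRelations {G : Type*} [Group G] (M : ℕ) (t : ℕ → G) : Prop where
  braid : ∀ i, i + 1 < M → t i * t (i + 1) * t i = t (i + 1) * t i * t (i + 1)
  comm : ∀ i j, i + 2 ≤ j → j < M → t i * t j = t j * t i

variable {G : Type*} [Group G] {M : ℕ} {t : ℕ → G}

/-- The product `t 0 * t 1 * ⋯ * t (j - 1)`. -/
def ascendingProd (t : ℕ → G) : ℕ → G
  | 0 => 1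
  | j + 1 => ascendingProd t j * t j

namespace BraidRelations

variable (ht : BraidRelations M t)

include ht

lemma comm' {i j : ℕ} (hi : i < M) (hj : j < M) (hij : i + 1 ≠ j) (hji : j + 1 ≠ i) :
    t i * t j = t j * t i := by
  rcases lt_trichotomy i j with h | rfl | h
  · exact ht.comm i j (by lia) hj
  · rfl
  · exact (ht.comm j i (by lia) hi).symm

lemma ascendingProd_comm {i j : ℕ} (hij : j < i) (hi : i < M) :
    ascendingProd t j * t i = t i * ascendingProd t j := by
  induction j with
  | zero => simp [ascendingProd]
  | succ j ih =>
    rw [ascendingProd, mul_assoc, ht.comm j i (by lia) hi, ← mul_assoc, ih (by lia), mul_assoc]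

lemma ascendingProd_mul {i j : ℕ} (hij : i + 2 ≤ j) (hj : j ≤ M) :
    ascendingProd t j * t i = t (i + 1) * ascendingProd t j := by
  induction j, hij using Nat.le_induction with
  | base =>
    have h : ascendingProd t (i + 2) = ascendingProd t i * (t i * t (i + 1)) := mul_assoc _ _ _
    rw [h, mul_assoc, ht.braid i (by lia), ← mul_assoc, ← mul_assoc,
      ht.ascendingProd_comm (Nat.lt_succ_self i) (by lia), mul_assoc, mul_assoc]
  | succ j hij ih =>
    rw [ascendingProd, mul_assoc, ← ht.comm i j hij (by lia), ← mul_assoc, ih (by lia), mul_assoc]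

lemma pow_ascendingProd_mul {i : ℕ} (hi : i < M) :
    ascendingProd t M ^ i * t 0 = t i * ascendingProd t M ^ i := by
  induction i with
  | zero => simp
  | succ i ih =>
    rw [pow_succ', mul_assoc, ih (by lia), ← mul_assoc,
      ht.ascendingProd_mul (by lia) le_rfl, mul_assoc]

/-- Conjugation by `t j * t (j + 1)` takes `t j` to `t (j + 1)` and fixes `t 0`, so the second
element can be moved outwards one step at a time. -/
lemma exists_conj_pair {j : ℕ} (h2 : 2 ≤ j) (hj : j < M) :
    ∃ g : G, g * t 0 = t 0 * g ∧ g * t 2 = t j * g := by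
  induction j, h2 using Nat.le_induction with
  | base => exact ⟨1, by simp, by simp⟩
  | succ j h2 ih =>
    obtain ⟨g, h0, hg⟩ := ih (by lia)
    refine ⟨t j * t (j + 1) * g, ?_, ?_⟩
    · rw [mul_assoc, h0, ← mul_assoc, mul_assoc (t j), ← ht.comm 0 (j + 1) (by lia) hj,
        ← mul_assoc, ← ht.comm 0 j (by lia) (by lia), mul_assoc, mul_assoc, mul_assoc]
    · rw [mul_assoc, hg, ← mul_assoc, ht.braid j hj, mul_assoc, mul_assoc, mul_assoc]

/-- The conjugator is the braid that crosses two adjacent pairs of strands. -/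
lemma exists_conj_swap {i : ℕ} (hi : i + 2 < M) :
    ∃ g : G, g * t i = t (i + 2) * g ∧ g * t (i + 2) = t i * g ∧
      ∀ j < M, (j + 1 < i ∨ i + 3 < j) → g * t j = t j * g := by
  have h1 := ht.braid i (by lia)
  have h2 := ht.braid (i + 1) hi
  have h3 := ht.comm i (i + 2) le_rfl hi
  refine ⟨t (i + 1) * t i * t (i + 2) * t (i + 1), ?_, ?_, fun j hj hij => ?_⟩
  · calc t (i + 1) * t i * t (i + 2) * t (i + 1) * t i
      _ = t (i + 1) * (t i * t (i + 2)) * t (i + 1) * t i := by group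
      _ = t (i + 1) * t (i + 2) * (t i * t (i + 1) * t i) := by rw [h3]; group
      _ = t (i + 1) * t (i + 2) * t (i + 1) * (t i * t (i + 1)) := by rw [h1]; group
      _ = t (i + 2) * t (i + 1) * (t (i + 2) * t i) * t (i + 1) := by rw [h2]; group
      _ = _ := by rw [← h3]; group
  · calc t (i + 1) * t i * t (i + 2) * t (i + 1) * t (i + 2)
      _ = t (i + 1) * t i * (t (i + 2) * t (i + 1) * t (i + 2)) := by group
      _ = t (i + 1) * t i * (t (i + 1) * t (i + 2) * t (i + 1)) := by rw [← h2]
      _ = (t (i + 1) * t i * t (i + 1)) * (t (i + 2) * t (i + 1)) := by group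
      _ = _ := by rw [← h1]; group
  · have h4 := ht.comm' (i := i) (j := j) (by lia) hj (by lia) (by lia)
    have h5 := ht.comm' (i := i + 1) (j := j) (by lia) hj (by lia) (by lia)
    have h6 := ht.comm' (i := i + 2) (j := j) (by lia) hj (by lia) (by lia)
    exact (((Commute.mul_left h5 h4).mul_left h6).mul_left h5).eq

end BraidRelations

end BraidRelations

/-! ### Joint eigenspaces of commuting isometries -/

section JointSpectrum

variable {H : Type*} [NormedAddCommGroup H] [InnerProductSpace ℂ H]

open Module

/-- The linear endomorphism underlying a linear isometry equivalence. -/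
abbrev LinearIsometryEquiv.toEnd (g : H ≃ₗᵢ[ℂ] H) : Module.End ℂ H := g.toLinearEquiv.toLinearMap

variable [FiniteDimensional ℂ H]

lemma LinearIsometryEquiv.map_eq_of_map_le (g : H ≃ₗᵢ[ℂ] H) {K : Submodule ℂ H}
    (hK : ∀ x ∈ K, g x ∈ K) : K.map g.toEnd = K :=
  Submodule.eq_of_le_of_finrank_eq (by rintro _ ⟨x, hx, rfl⟩; exact hK x hx)
    (finrank_map_linearIsometryEquiv g K)

/-- Orthogonal complements of invariant subspaces are invariant. Generalized eigenspaces are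
therefore eigenspaces, which reconciles the definition of `jointEigenspace` with its use. -/
lemma LinearIsometryEquiv.isFinitelySemisimple_toEnd (g : H ≃ₗᵢ[ℂ] H) :
    g.toEnd.IsFinitelySemisimple := by
  refine Module.End.isFinitelySemisimple_iff.mpr fun p hp₁ hp₂ q hq₁ hq₂ ↦
    ⟨qᗮ ⊓ p, inf_le_right, Module.End.invtSubmodule.inf_mem ?_ hp₁, ?_, ?_⟩
  · intro x hx y hy
    rw [← g.map_eq_of_map_le (K := q) fun x hx => hq₁ hx] at hy
    obtain ⟨z, hz, rfl⟩ := hy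
    exact (g.inner_map_map z x).trans (hx z hz)
  · simp [disjoint_iff, ← inf_assoc, Submodule.inf_orthogonal_eq_bot q]
  · suffices q ⊔ qᗮ = ⊤ by rw [← sup_inf_assoc_of_le _ hq₂, this, top_inf_eq p]
    exact Submodule.sup_orthogonal_of_hasOrthogonalProjection

/-- The joint eigenspace of a family of isometries for a family of eigenvalues. -/
def jointEigenspace {ι : Type*} (T : ι → H ≃ₗᵢ[ℂ] H) (χ : ι → ℂ) : Submodule ℂ H :=
  ⨅ i, (T i).toEnd.maxGenEigenspace (χ i)

variable {ι : Type*} {T : ι → H ≃ₗᵢ[ℂ] H}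

lemma mem_jointEigenspace {χ : ι → ℂ} {x : H} :
    x ∈ jointEigenspace T χ ↔ ∀ i, T i x = χ i • x := by
  simp only [jointEigenspace, Submodule.mem_iInf,
    (T _).isFinitelySemisimple_toEnd.maxGenEigenspace_eq_eigenspace, Module.End.mem_eigenspace_iff]
  rfl

omit [FiniteDimensional ℂ H] in
lemma commute_toEnd (hT : ∀ i j, T i * T j = T j * T i) (i j : ι) :
    Commute (T i).toEnd (T j).toEnd :=
  LinearMap.ext fun x => LinearIsometryEquiv.congr_fun (hT i j) x

variable (hT : ∀ i j, T i * T j = T j * T i)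

include hT

omit [FiniteDimensional ℂ H] in
lemma iSupIndep_jointEigenspace : iSupIndep (jointEigenspace T) :=
  Module.End.independent_iInf_maxGenEigenspace_of_forall_mapsTo _ fun i j _ =>
    Module.End.mapsTo_maxGenEigenspace_of_comm (commute_toEnd hT j i) _

lemma iSup_jointEigenspace : ⨆ χ, jointEigenspace T χ = ⊤ :=
  Module.End.iSup_iInf_maxGenEigenspace_eq_top_of_iSup_maxGenEigenspace_eq_top_of_commute _
    (fun i j _ => commute_toEnd hT i j) fun _ => Module.End.iSup_maxGenEigenspace_eq_top _

lemma finite_jointEigenspace_ne_bot : {χ | jointEigenspace T χ ≠ ⊥}.Finite :=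
  have : Fintype {χ // jointEigenspace T χ ≠ ⊥} :=
    (iSupIndep_jointEigenspace hT).fintypeNeBotOfFiniteDimensional
  Set.finite_coe_iff.mp (Finite.of_fintype {χ // jointEigenspace T χ ≠ ⊥})

lemma ncard_jointEigenspace_ne_bot_le : {χ | jointEigenspace T χ ≠ ⊥}.ncard ≤ finrank ℂ H := by
  have : Fintype {χ // jointEigenspace T χ ≠ ⊥} :=
    (iSupIndep_jointEigenspace hT).fintypeNeBotOfFiniteDimensional
  rw [← Nat.card_coe_set_eq]
  exact (Nat.card_eq_fintype_card (α := {χ // jointEigenspace T χ ≠ ⊥})).trans_le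
    (iSupIndep_jointEigenspace hT).subtype_ne_bot_le_finrank

open Classical in
/-- Every vector is a sum of joint eigenvectors such that any product
`(T i - c) (T j - c)` killing the vector kills all summands. -/
lemma exists_dfinsupp_jointEigenspace (v : H) (c : ℂ) : ∃ f : Π₀ χ, jointEigenspace T χ,
    DFinsupp.lsum ℕ (fun χ => (jointEigenspace T χ).subtype) f = v ∧
    ∀ i j, ((T i).toEnd - algebraMap ℂ _ c) (((T j).toEnd - algebraMap ℂ _ c) v) = 0 ↔
      ∀ χ, f χ ≠ 0 → χ i = c ∨ χ j = c := by
  have hv : v ∈ ⨆ χ, jointEigenspace T χ := by rw [iSup_jointEigenspace hT]; trivial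
  obtain ⟨f, rfl⟩ := (Submodule.mem_iSup_iff_exists_dfinsupp _ _).mp hv
  refine ⟨f, rfl, fun i j => ?_⟩
  have h1 : ((T i).toEnd - algebraMap ℂ _ c) (((T j).toEnd - algebraMap ℂ _ c)
      (DFinsupp.lsum ℕ (fun χ => (jointEigenspace T χ).subtype) f)) =
      DFinsupp.lsum ℕ (fun χ => (jointEigenspace T χ).subtype)
        (f.mapRange (fun χ x => ((χ i - c) * (χ j - c)) • x) fun χ => smul_zero _) := by
    clear hv
    induction f using DFinsupp.induction with
    | h0 => simp
    | ha χ x f _ _ ih =>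
      rw [DFinsupp.mapRange_add _ _ (fun χ x y => smul_add _ x y), map_add, map_add, map_add,
        map_add, ih, DFinsupp.mapRange_single]
      congr 1
      have hx (i : ι) : ((T i).toEnd - algebraMap ℂ _ c) (x : H) = (χ i - c) • (x : H) := by
        rw [LinearMap.sub_apply, Module.algebraMap_end_apply, sub_smul,
          ← mem_jointEigenspace.mp x.2 i]
        rfl
      simp only [DFinsupp.lsum_single, Submodule.subtype_apply, hx, map_smul, smul_smul,
        mul_comm]
  rw [h1]
  constructor
  · intro h χ hχ
    have h2 := iSupIndep.dfinsupp_lsum_injective (iSupIndep_jointEigenspace hT)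
      (h.trans (map_zero _).symm)
    have h3 := DFunLike.congr_fun h2 χ
    rw [DFinsupp.mapRange_apply, DFinsupp.zero_apply, smul_eq_zero] at h3
    rcases mul_eq_zero.mp (h3.resolve_right hχ) with h4 | h4
    · exact Or.inl (sub_eq_zero.mp h4)
    · exact Or.inr (sub_eq_zero.mp h4)
  · intro h
    have h2 : f.mapRange (fun χ x => ((χ i - c) * (χ j - c)) • x)
        (fun χ => smul_zero _) = 0 := by
      ext χ : 1
      rw [DFinsupp.mapRange_apply, DFinsupp.zero_apply]
      by_cases hχ : f χ = 0
      · rw [hχ, smul_zero]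
      · rcases h χ hχ with h | h <;> simp [h]
    rw [h2, map_zero]

end JointSpectrum

/-! ### Irreducible unitary representations of small dimension -/

section Irreducible

variable {H : Type*} [NormedAddCommGroup H] [InnerProductSpace ℂ H] [FiniteDimensional ℂ H]

open Module

variable {M p : ℕ} {t : ℕ → H ≃ₗᵢ[ℂ] H}

/-- The element of `exists_conj_swap` carries a joint eigenvector to one with two adjacent
eigenvalues exchanged. -/
lemma BraidRelations.jointEigenspace_comp_swap_ne_bot (ht : BraidRelations M t)
    (hp : 2 * p ≤ M + 1) {χ : Fin p → ℂ}
    (hχ : jointEigenspace (fun a : Fin p => t (2 * a)) χ ≠ ⊥) (i : ℕ) (hi : i + 1 < p) :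
    jointEigenspace (fun a : Fin p => t (2 * a))
      (χ ∘ Equiv.swap (⟨i, by lia⟩ : Fin p) ⟨i + 1, hi⟩) ≠ ⊥ := by
  obtain ⟨g, h1, h2, h3⟩ := ht.exists_conj_swap (i := 2 * i) (by lia)
  obtain ⟨v, hv, hv0⟩ := (Submodule.ne_bot_iff _).mp hχ
  rw [mem_jointEigenspace] at hv
  refine (Submodule.ne_bot_iff _).mpr ⟨g v, mem_jointEigenspace.mpr fun a => ?_, by simpa using hv0⟩
  have key : ∀ b : Fin p, g * t (2 * b) = t (2 * a) * g → t (2 * a) (g v) = χ b • g v := by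
    intro b hb
    have := LinearIsometryEquiv.congr_fun hb v
    rw [← map_smul, ← hv b]
    exact this.symm
  refine key _ ?_
  rcases eq_or_ne a ⟨i, by lia⟩ with rfl | hai
  · rw [Equiv.swap_apply_left]; exact h2
  rcases eq_or_ne a ⟨i + 1, hi⟩ with rfl | hai'
  · rw [Equiv.swap_apply_right]; exact h1
  · rw [Equiv.swap_apply_of_ne_of_ne hai hai']
    have := a.2
    rw [ne_eq, Fin.ext_iff] at hai hai'
    exact h3 _ (by lia) (by grind)

/-- In an irreducible unitary representation of small dimension, some eigenvalue `c` satisfies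
`(t 0 - c) (t 2 - c) = 0`. -/
lemma BraidRelations.exists_mul_eq_zero [Nontrivial H] (ht : BraidRelations M t)
    (hirr : ∀ K : Submodule ℂ H, (∀ i < M, ∀ x ∈ K, t i x ∈ K) → K = ⊥ ∨ K = ⊤)
    (hp5 : 5 ≤ p) (hp : 2 * p ≤ M + 1) (hm : finrank ℂ H < p.choose 2) :
    ∃ c : ℂ, ∀ x, ((t 0).toEnd - algebraMap ℂ _ c) (((t 2).toEnd - algebraMap ℂ _ c) x) = 0 := by
  classical
  set T : Fin p → H ≃ₗᵢ[ℂ] H := fun a => t (2 * a) with hTdef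
  have hT : ∀ a b, T a * T b = T b * T a := fun a b =>
    ht.comm' (by lia) (by lia) (by lia) (by lia)
  have hO {χ : Fin p → ℂ} (hχ : jointEigenspace T χ ≠ ⊥) :
      ∃ c, ∀ i j, i ≠ j → χ i = c ∨ χ j = c :=
    exists_eq_or_eq_of_ncard_lt (by lia) (finite_jointEigenspace_ne_bot hT)
      (comp_perm_mem_of_comp_swap_mem fun f hf i hi =>
        ht.jointEigenspace_comp_swap_ne_bot hp hf i hi)
      ((ncard_jointEigenspace_ne_bot_le hT).trans_lt hm) hχ
  obtain ⟨χ, hχ⟩ : ∃ χ, jointEigenspace T χ ≠ ⊥ := by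
    by_contra! h
    have := iSup_jointEigenspace hT
    simp only [h, iSup_bot] at this
    exact bot_ne_top this
  obtain ⟨c, hc⟩ := hO hχ
  let X (a b : Fin p) : Module.End ℂ H :=
    ((T a).toEnd - algebraMap ℂ _ c) * ((T b).toEnd - algebraMap ℂ _ c)
  let K : Submodule ℂ H := ⨅ (a) (b) (_ : a ≠ b), LinearMap.ker (X a b)
  have hK {x : H} : x ∈ K ↔ ∀ a b, a ≠ b → X a b x = 0 := by
    simp only [K, Submodule.mem_iInf, LinearMap.mem_ker]
  -- Three indices suffice by majority: for each tuple `ψ` occurring in `x`, at least two of its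
  -- three entries equal `c` and at least two equal its generic value `d`, so `c = d`.
  have htriple {a₁ a₂ a₃ : Fin p} (h12 : a₁ ≠ a₂) (h13 : a₁ ≠ a₃) (h23 : a₂ ≠ a₃) {x : H}
      (x12 : X a₁ a₂ x = 0) (x13 : X a₁ a₃ x = 0) (x23 : X a₂ a₃ x = 0) : x ∈ K := by
    obtain ⟨f, -, hf⟩ := exists_dfinsupp_jointEigenspace hT x c
    rw [hK]
    intro a b hab
    refine (hf a b).mpr fun ψ hψ => ?_
    have hψ' : jointEigenspace T ψ ≠ ⊥ :=
      (Submodule.ne_bot_iff _).mpr ⟨f ψ, (f ψ).2, by simpa using hψ⟩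
    obtain ⟨d, hd⟩ := hO hψ'
    have e12 := (hf a₁ a₂).mp x12 ψ hψ
    have e13 := (hf a₁ a₃).mp x13 ψ hψ
    have e23 := (hf a₂ a₃).mp x23 ψ hψ
    have f12 := hd a₁ a₂ h12
    have f13 := hd a₁ a₃ h13
    have f23 := hd a₂ a₃ h23
    have hcd : c = d := by grind
    rw [hcd]
    exact hd a b hab
  have hinv : ∀ i < M, ∀ x ∈ K, t i x ∈ K := by
    intro i hi x hx
    have hcomm (a : Fin p) (ha : (2 * a : ℕ) + 1 ≠ i) (ha' : i + 1 ≠ 2 * a) :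
        Commute ((T a).toEnd - algebraMap ℂ _ c) (t i).toEnd := by
      have h1 : T a * t i = t i * T a := ht.comm' (by lia) hi ha ha'
      have h2 : Commute (T a).toEnd (t i).toEnd :=
        LinearMap.ext fun x => LinearIsometryEquiv.congr_fun h1 x
      exact h2.sub_left (Algebra.commute_algebraMap_left c _)
    have hX (a b : Fin p) (hab : a ≠ b) (ha : (2 * a : ℕ) + 1 ≠ i) (ha' : i + 1 ≠ 2 * a)
        (hb : (2 * b : ℕ) + 1 ≠ i) (hb' : i + 1 ≠ 2 * b) : X a b (t i x) = 0 := by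
      have h := LinearMap.congr_fun ((hcomm a ha ha').mul_left (hcomm b hb hb')).eq x
      refine h.trans ?_
      change t i (X a b x) = 0
      rw [hK.mp hx a b hab, map_zero]
    -- At most two of the even generators are adjacent to `t i`, so `5 ≤ p` leaves three that
    -- commute with it.
    have hex : ∃ a₁ a₂ a₃ : ℕ, a₁ < p ∧ a₂ < p ∧ a₃ < p ∧ a₁ ≠ a₂ ∧ a₁ ≠ a₃ ∧ a₂ ≠ a₃ ∧
        2 * a₁ + 1 ≠ i ∧ i + 1 ≠ 2 * a₁ ∧ 2 * a₂ + 1 ≠ i ∧ i + 1 ≠ 2 * a₂ ∧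
        2 * a₃ + 1 ≠ i ∧ i + 1 ≠ 2 * a₃ := by
      by_cases h1 : i ≤ 2
      · exact ⟨2, 3, 4, by lia⟩
      · by_cases h2 : i ≤ 6
        · by_cases h3 : i ≤ 4
          · exact ⟨0, 3, 4, by lia⟩
          · exact ⟨0, 1, 4, by lia⟩
        · exact ⟨0, 1, 2, by lia⟩
    obtain ⟨a₁, a₂, a₃, l1, l2, l3, h12, h13, h23, g1, g1', g2, g2', g3, g3'⟩ := hex
    have n12 : (⟨a₁, l1⟩ : Fin p) ≠ ⟨a₂, l2⟩ := by simpa using h12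
    have n13 : (⟨a₁, l1⟩ : Fin p) ≠ ⟨a₃, l3⟩ := by simpa using h13
    have n23 : (⟨a₂, l2⟩ : Fin p) ≠ ⟨a₃, l3⟩ := by simpa using h23
    exact htriple n12 n13 n23 (hX _ _ n12 g1 g1' g2 g2') (hX _ _ n13 g1 g1' g3 g3')
      (hX _ _ n23 g2 g2' g3 g3')
  have hKtop : K = ⊤ := by
    refine (hirr K hinv).resolve_left ?_
    obtain ⟨v, hv, hv0⟩ := (Submodule.ne_bot_iff _).mp hχ
    refine (Submodule.ne_bot_iff _).mpr ⟨v, hK.mpr fun a b hab => ?_, hv0⟩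
    have hv' (a : Fin p) : ((T a).toEnd - algebraMap ℂ _ c) v = (χ a - c) • v := by
      rw [LinearMap.sub_apply, Module.algebraMap_end_apply, sub_smul,
        ← mem_jointEigenspace.mp hv a]
      rfl
    rw [Module.End.mul_apply, hv', map_smul, hv', smul_smul]
    rcases hc a b hab with h | h <;> simp [h]
  refine ⟨c, fun x => ?_⟩
  exact hK.mp (hKtop ▸ Submodule.mem_top : x ∈ K) ⟨0, by lia⟩ ⟨1, by lia⟩ (by simp)

omit [FiniteDimensional ℂ H] in
-- For unitary `g` the range of `g - c` is orthogonal to the `c`-eigenspace; this is where unitarity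
-- produces the orthogonality of distant translates.
lemma inner_eq_zero_of_apply_eq_smul (g : H ≃ₗᵢ[ℂ] H) {c : ℂ} {y : H} (hy : g y = c • y) (x : H) :
    inner ℂ (g x - c • x) y = 0 := by
  rcases eq_or_ne y 0 with rfl | hy0
  · simp
  have hc : ‖c‖ = 1 := by
    have h := g.norm_map y
    rw [hy, norm_smul] at h
    exact mul_right_cancel₀ (norm_ne_zero_iff.mpr hy0) (h.trans (one_mul _).symm)
  have h1 : c * inner ℂ (g x) y = inner ℂ x y := by
    rw [← inner_smul_right, ← hy, g.inner_map_map]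
  rw [inner_sub_left, inner_smul_left, ← h1, ← mul_assoc, Complex.conj_mul', hc]
  simp

/-- A unitary representation of the braid group with `M` generators that is irreducible and of
small dimension has dimension `1` or dimension about `k M`. -/
theorem BraidRelations.finrank_eq_one_or_exists_bounds [Nontrivial H] (ht : BraidRelations M t)
    (hirr : ∀ K : Submodule ℂ H, (∀ i < M, ∀ x ∈ K, t i x ∈ K) → K = ⊥ ∨ K = ⊤)
    (hp5 : 5 ≤ p) (hp : 2 * p ≤ M + 1) (hm : finrank ℂ H < p.choose 2)
    (hr : ∀ r, p * r ≤ finrank ℂ H → 4 * r + 4 ≤ M) :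
    finrank ℂ H = 1 ∨
      ∃ k, 1 ≤ k ∧ k * (M - 1) ≤ finrank ℂ H ∧ finrank ℂ H ≤ k * (M + 1) := by
  obtain ⟨c, hc⟩ := ht.exists_mul_eq_zero hirr hp5 hp hm
  set U := ascendingProd t M with hU
  have hUt {i : ℕ} (hi : i < M) (x : H) : (U ^ i) (t 0 x) = t i ((U ^ i) x) :=
    LinearIsometryEquiv.congr_fun (ht.pow_ascendingProd_mul hi) x
  set V : Submodule ℂ H := LinearMap.range ((t 0).toEnd - algebraMap ℂ _ c) with hVdef
  have hV {y : H} : y ∈ V ↔ ∃ x, t 0 x - c • x = y := Iff.rfl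
  have hfar {j : ℕ} (h2 : 2 ≤ j) (hj : j < M) (x : H) :
      t 0 (t j x - c • x) = c • (t j x - c • x) := by
    obtain ⟨g, h0, hg⟩ := ht.exists_conj_pair h2 hj
    obtain ⟨z, rfl⟩ := g.surjective x
    have h0' (x : H) : g (t 0 x) = t 0 (g x) := LinearIsometryEquiv.congr_fun h0 x
    have hg' (x : H) : g (t 2 x) = t j (g x) := LinearIsometryEquiv.congr_fun hg x
    have h1 : t 0 (t 2 z - c • z) - c • (t 2 z - c • z) = 0 := hc z
    have h3 := congrArg g (sub_eq_zero.mp h1)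
    rwa [h0', map_smul, map_sub, hg', map_smul] at h3
  have hVU {i : ℕ} (hi : i < M) (x : H) :
      t i x - c • x ∈ V.map (U ^ i).toLinearEquiv.toLinearMap := by
    obtain ⟨z, rfl⟩ := (U ^ i).surjective x
    refine ⟨t 0 z - c • z, hV.mpr ⟨z, rfl⟩, ?_⟩
    change (U ^ i) (t 0 z - c • z) = _
    rw [map_sub, map_smul, hUt hi]
  have hFar : FarOrthogonal U V (M - 1) := by
    rintro j h2 hj _ ⟨x, rfl⟩ _ ⟨y, rfl⟩
    refine inner_eq_zero_of_apply_eq_smul (t 0) ?_ x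
    change t 0 ((U ^ j) (t 0 y - c • y)) = c • (U ^ j) (t 0 y - c • y)
    rw [map_sub, map_smul, hUt (by lia), hfar h2 (by lia)]
  have hM : M - 1 + 1 = M := by lia
  by_cases hVbot : V = ⊥
  · left
    have hsc {i : ℕ} (hi : i < M) (x : H) : t i x = c • x := by
      have := hVU hi x
      rw [hVbot, Submodule.map_bot, Submodule.mem_bot, sub_eq_zero] at this
      exact this
    obtain ⟨v, hv⟩ := exists_ne (0 : H)
    have h1 := (hirr (ℂ ∙ v) fun i hi x hx => by
      rw [hsc hi]; exact Submodule.smul_mem _ _ hx).resolve_left (by simpa using hv)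
    rw [← finrank_top, ← h1, finrank_span_singleton hv]
  · right
    have hspan : shiftSpan U V (M - 1 + 1) = ⊤ := by
      rw [hM]
      -- The span is invariant because `t i x` differs from `c • x` by a vector of `U ^ i V`.
      refine (hirr _ fun i hi x hx => ?_).resolve_left fun h => hVbot ?_
      · have h1 : t i x - c • x ∈ shiftSpan U V M := by
          obtain ⟨z, hz, hzx⟩ := hVU hi x
          rw [← hzx]
          exact pow_apply_mem_shiftSpan hi hz
        have h2 := Submodule.add_mem _ h1 (Submodule.smul_mem _ c hx)
        rwa [sub_add_cancel] at h2
      · rw [eq_bot_iff, ← h]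
        intro x hx
        have := pow_apply_mem_shiftSpan (U := U) (i := 0) (j := M) (by lia) hx
        rwa [pow_zero] at this
    -- The translates of `V` by even powers of `U` are mutually orthogonal, so `p * dim V ≤ dim H`.
    -- Through `hr` this makes `V` small enough for the chain argument.
    have hdim : ∀ q, 2 * (q + 1) ≤ M + 1 →
        (q + 1) * finrank ℂ V ≤ finrank ℂ (shiftSpan U V (2 * q + 1)) := by
      intro q
      induction q with
      | zero =>
        intro _
        refine (zero_add 1).symm ▸ (one_mul (finrank ℂ V)).trans_le (Submodule.finrank_mono ?_)
        rw [shiftSpan_succ']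
        exact le_sup_left
      | succ q ih =>
        intro hq
        have h1 := ih (by lia)
        have h2 := hFar.finrank_shiftSpan_add_le (a := 2 * q + 1) (j := 1) (by lia)
        have h3 : finrank ℂ V ≤ finrank ℂ (shiftSpan U V 1) := by
          refine Submodule.finrank_mono ?_
          rw [shiftSpan_succ']
          exact le_sup_left
        rw [add_mul (q + 1), one_mul]
        have h4 : 2 * q + 1 + 1 + 1 = 2 * (q + 1) + 1 := by ring
        rw [h4] at h2
        lia
    obtain ⟨q, rfl⟩ : ∃ q, p = q + 1 := ⟨p - 1, by lia⟩
    have hr' := hr _ ((hdim q hp).trans (Submodule.finrank_le _))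
    obtain ⟨k, hk1, hk2, hk3⟩ := hFar.exists_finrank_bounds hVbot hspan (by lia)
    refine ⟨k, hk1, hk2, ?_⟩
    rwa [show M - 1 + 2 = M + 1 by lia] at hk3

end Irreducible

/-! ### From dimension bounds to levels -/

section LevelArithmetic

namespace UnitaryBraidRep

variable {n m : ℕ} {φ : UnitaryBraidRep n m}

lemma IsOfLevel.le_of_isOfLevel {a b l : ℕ} (ha : φ.IsOfLevel a) (hb : φ.IsOfLevel b) (hbl : b ≤ l)
    (hn : l ^ 2 + 3 * l + 3 ≤ n) : b ≤ a := by
  by_contra! hab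
  have hn' : (l : ℤ) ^ 2 + 3 * l + 3 ≤ n := by exact_mod_cast hn
  have hbl' : (b : ℤ) ≤ l := by exact_mod_cast hbl
  have hab' : (a : ℤ) + 1 ≤ b := by exact_mod_cast hab
  have hb2 : (b : ℤ) ^ 2 ≤ (l : ℤ) ^ 2 := by gcongr
  rcases hb with ⟨h, -⟩ | ⟨hb1, hb2', -⟩
  · lia
  · rcases ha with ⟨rfl, rfl⟩ | ⟨-, -, ha⟩
    · have : (1 : ℤ) * n ≤ b * n := by gcongr; exact_mod_cast hb1
      push_cast at hb2'
      linarith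
    · have : ((a : ℤ) + 1) * n ≤ b * n := by gcongr
      linarith

lemma existsUnique_isOfLevel {l : ℕ} (hn : l ^ 2 + 3 * l + 3 ≤ n) (hm : m ≤ l * n)
    (h : m = 1 ∨ ∃ k, 1 ≤ k ∧ k * (n - 2) ≤ m ∧ m ≤ k * n) :
    ∃! k : ℕ, k ≤ l ∧ φ.IsOfLevel k := by
  refine existsUnique_of_exists_of_unique ?_ fun a b ha hb =>
    le_antisymm (hb.2.le_of_isOfLevel ha.2 ha.1 hn) (ha.2.le_of_isOfLevel hb.2 hb.1 hn)
  rcases h with h | ⟨k, hk1, hlow, hup⟩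
  · exact ⟨0, Nat.zero_le _, Or.inl ⟨rfl, h⟩⟩
  · refine ⟨k, ?_, Or.inr ⟨hk1, ?_, by exact_mod_cast hup⟩⟩
    -- If `l < k`, then `(l + 1) (n - 2) ≤ m ≤ l n`, so `n ≤ 2 l + 2`.
    · by_contra! hlk
      obtain ⟨r, rfl⟩ : ∃ r, n = r + 2 := ⟨n - 2, by lia⟩
      rw [Nat.add_sub_cancel] at hlow
      have h1 : (l + 1) * r ≤ k * r := Nat.mul_le_mul_right _ hlk
      have h2 : (l + 1) * r ≤ l * (r + 2) := h1.trans (hlow.trans hm)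
      nlinarith
    -- The bound `k n - 2 k ≤ m` is at least as strong as the required one, since `2 k ≤ k² + 3 k -
    -- 2` for `k ≥ 1`.
    · have h1 : ((k : ℤ)) * (n - 2) ≤ m := by
        have : ((n - 2 : ℕ) : ℤ) = n - 2 := by
          rw [Nat.cast_sub (by nlinarith)]; rfl
        rw [← this]
        exact_mod_cast hlow
      have h2 : (1 : ℤ) ≤ k := by exact_mod_cast hk1
      nlinarith

end UnitaryBraidRep

end LevelArithmetic

/-! ### Unitary braid representations as isometries, and the theorem -/

namespace UnitaryBraidRep

variable {n m : ℕ} (φ : UnitaryBraidRep n m)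

/-- The action of the braid group on the Euclidean space by linear isometries. -/
noncomputable def toIsometry :
    BraidGroup n →* (EuclideanSpace ℂ (Fin m) ≃ₗᵢ[ℂ] EuclideanSpace ℂ (Fin m)) :=
  (Unitary.linearIsometryEquiv.toMonoidHom.comp
    (Unitary.map
      { toMonoidHom := (Matrix.toEuclideanCLM (n := Fin m) (𝕜 := ℂ) : _ →* _)
        map_star' := map_star (Matrix.toEuclideanCLM (n := Fin m) (𝕜 := ℂ)) }).toMonoidHom).comp φ

lemma toIsometry_apply (g : BraidGroup n) (x : Fin m → ℂ) :
    φ.toIsometry g (WithLp.toLp 2 x) = WithLp.toLp 2 (φ.toRepresentation g x) := rfl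

/-- The isometries by which the generators act; the identity for indices out of range. -/
noncomputable def generator (i : ℕ) : EuclideanSpace ℂ (Fin m) ≃ₗᵢ[ℂ] EuclideanSpace ℂ (Fin m) :=
  if h : i < n - 1 then φ.toIsometry (PresentedGroup.of ⟨i, h⟩) else 1

lemma braidRelations_generator : BraidRelations (n - 1) φ.generator where
  braid i hi := by
    rw [generator, generator, dif_pos hi, dif_pos (Nat.lt_of_succ_lt hi), ← map_mul, ← map_mul,
      ← map_mul, ← map_mul]
    exact congrArg _ (PresentedGroup.mk_eq_mk_of_mul_inv_mem
      ⟨⟨i, by lia⟩, ⟨i + 1, hi⟩, Or.inl ⟨by simp, rfl⟩⟩)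
  comm i j hij hj := by
    rw [generator, generator, dif_pos hj, dif_pos (by lia), ← map_mul, ← map_mul]
    refine congrArg _ (PresentedGroup.mk_eq_mk_of_mul_inv_mem
      ⟨⟨i, by lia⟩, ⟨j, hj⟩, Or.inr ⟨fun h => ?_, rfl⟩⟩)
    rw [abs_eq zero_le_one] at h
    simp only at h
    lia

variable {φ}

/-- In finite dimension an isometry preserving `K` maps it onto `K`, so invariance under the
generators passes to inverses and hence to the whole group. -/
lemma IsIrreducible.eq_bot_or_eq_top (hφ : φ.IsIrreducible)
    (K : Submodule ℂ (EuclideanSpace ℂ (Fin m)))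
    (hK : ∀ i < n - 1, ∀ x ∈ K, φ.generator i x ∈ K) : K = ⊥ ∨ K = ⊤ := by
  have hmap : ∀ g, K.map (φ.toIsometry g).toEnd = K := by
    intro g
    have hg : g ∈ Subgroup.closure (Set.range (PresentedGroup.of (rels := braidRels n))) := by
      rw [PresentedGroup.closure_range_of]; trivial
    induction hg using Subgroup.closure_induction with
    | mem x hx =>
      obtain ⟨i, rfl⟩ := hx
      refine LinearIsometryEquiv.map_eq_of_map_le _ fun x hx => ?_
      have := hK i i.2 x hx
      rwa [generator, dif_pos i.2] at this
    | one => rw [map_one]; exact Submodule.map_id K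
    | mul x y _ _ hx hy =>
      rw [map_mul]
      refine (Submodule.map_comp (φ.toIsometry y).toEnd (φ.toIsometry x).toEnd K).trans ?_
      rw [hy, hx]
    | inv x _ hx =>
      nth_rewrite 1 [← hx]
      rw [← Submodule.map_comp, map_inv]
      have h : (φ.toIsometry x)⁻¹.toEnd ∘ₗ (φ.toIsometry x).toEnd = LinearMap.id :=
        LinearMap.ext (φ.toIsometry x).symm_apply_apply
      rw [h, Submodule.map_id]
  have : IsSimpleOrder (Subrepresentation φ.toRepresentation) := hφ
  let S : Subrepresentation φ.toRepresentation :=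
    ⟨K.comap (WithLp.linearEquiv 2 ℂ (Fin m → ℂ)).symm.toLinearMap, fun g v hv => by
      have h : φ.toIsometry g (WithLp.toLp 2 v) ∈ K.map (φ.toIsometry g).toEnd := ⟨_, hv, rfl⟩
      rw [hmap, toIsometry_apply] at h
      exact h⟩
  have hS (x : EuclideanSpace ℂ (Fin m)) : x.ofLp ∈ S.toSubmodule ↔ x ∈ K := Iff.rfl
  rcases IsSimpleOrder.eq_bot_or_eq_top S with h | h
  · left
    rw [Submodule.eq_bot_iff]
    intro x hx
    rw [← hS, h] at hx
    have hx' : x.ofLp = 0 := hx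
    ext i
    exact congrFun hx' i
  · right
    rw [Submodule.eq_top_iff']
    intro x
    rw [← hS, h]
    trivial

lemma IsIrreducible.nontrivial (hφ : φ.IsIrreducible) :
    Nontrivial (EuclideanSpace ℂ (Fin m)) := by
  have : IsSimpleOrder (Subrepresentation φ.toRepresentation) := hφ
  by_contra h
  rw [not_nontrivial_iff_subsingleton] at h
  refine bot_ne_top (α := Subrepresentation φ.toRepresentation)
    (Subrepresentation.toSubmodule_injective ?_)
  have : Subsingleton (Fin m → ℂ) := (WithLp.equiv 2 (Fin m → ℂ)).symm.subsingleton
  exact Subsingleton.elim _ _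

end UnitaryBraidRep

theorem theoremt (l : ℕ) (hl : 1 ≤ l) :
    ∃ N : ℕ, ∀ n : ℕ, N ≤ n → ∀ (m : ℕ) (φ : UnitaryBraidRep n m),
      φ.IsIrreducible → m ≤ l * n → ∃! k : ℕ, k ≤ l ∧ φ.IsOfLevel k := by
  -- The quadratic part separates the levels up to `l`. The linear part gives `6 l + 9 ≤ p`, which
  -- makes `l n < p.choose 2`.
  refine ⟨l ^ 2 + 12 * l + 20, fun n hn m φ hφ hm => ?_⟩
  refine UnitaryBraidRep.existsUnique_isOfLevel (by lia) hm ?_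
  have := hφ.nontrivial
  obtain ⟨p, hp⟩ : ∃ p, p = n / 2 := ⟨_, rfl⟩
  have hp1 : 2 * p ≤ n := by lia
  have hp2 : n ≤ 2 * p + 1 := by lia
  have hpl : 6 * l + 9 ≤ p := by have := Nat.zero_le (l ^ 2); lia
  have hmp : m < p.choose 2 := by
    rw [Nat.choose_two_right, Nat.lt_div_iff_mul_lt' (Nat.two_dvd_mul_sub_one p)]
    obtain ⟨q, rfl⟩ : ∃ q, p = q + 1 := ⟨p - 1, by lia⟩
    rw [Nat.add_sub_cancel]
    nlinarith
  have h := φ.braidRelations_generator.finrank_eq_one_or_exists_bounds (p := p)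
    hφ.eq_bot_or_eq_top (by lia) (by lia) (by rwa [finrank_euclideanSpace_fin]) fun r hr => by
      rw [finrank_euclideanSpace_fin] at hr
      -- From `p r ≤ l n ≤ l (2 p + 1) ≤ 3 l p`.
      have hr3 : r ≤ 3 * l := by
        by_contra! h3
        nlinarith
      have := Nat.zero_le (l ^ 2)
      lia
  rw [finrank_euclideanSpace_fin] at h
  rwa [show n - 1 - 1 = n - 2 by lia, show n - 1 + 1 = n by lia] at h
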